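/- **Syntax and semantics.** Fix countably infinite sets of concept names, role names, individual names and variables. A knowledge base (KB) $\mathcal K=(\mathcal T,\mathcal A)$ consists of a finite TBox $\mathcal T$ and a finite non-empty ABox $\mathcal A$. The TBox is a set of concept inclusions in the normal forms $$A_1\sqcap\dots\sqcap A_k\sqsubseteq B_1\sqcup\dots\sqcup B_l,\quad A\sqsubseteq{\le}n\,r.B,\quad A\sqsubseteq{\ge}n\,r.B,\quad A\sqsubseteq{\le}n\,r^*.B,\quad A\sqsubseteq{\ge}n\,r^*.B,$$ $$A\sqsubseteq\forall r^-.B,\quad A\sqsubseteq\exists r^-.B,\quad A\sqsubseteq\exists (r^-)^*.B,$$ with $A,B,A_i,B_j$ concept names, $k,l,n\ge 0$, $r$ a role name, $r^-$ its inverse and $r^*$ its reflexive-transitive closure (the empty conjunction is $\top$, the empty disjunction is $\bot$). The ABox is a set of assertions $A(a)$, $r(a,b)$, $r^*(a,b)$. Let $\mathrm{CN}(\mathcal K)$ be the set of concept names occurring in $\mathcal K$. We say that $\mathcal K$ is an $\mathcal{ALCI}^+$ KB if it does not count, i.e. $n=0$ in all its at-most restrictions (${\le}n$) and $n=1$ in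 all its at-least restrictions (${\ge}n$), and that it is an $\mathcal{ALCQ}^+$ KB if it uses no inverse roles. It is *single-role* (with role name $r$) if no role name other than $r$ occurs in it, and *ABox-trivial* if its ABox contains only assertions of the form $A(a)$ and exactly one individual name occurs in it. Interpretations $\mathcal I$ have a non-empty domain $\Delta^{\mathcal I}$ and interpret concept names by subsets of it and role names by binary relations on it, with the standard semantics of concept inclusions and assertions and under the standard name assumption $a^{\mathcal I}=a$ for individual names (so $a\in\Delta^{\mathcal I}$ for every individual $a$ of $\mathcal K$ if $\mathcal I$ is a model of $\mathcal K$, and an atom mentioning an individual outside $\Delta^{\mathcal I}$ is not satisfied). A (plain) union of conjunctive queries (UCQ) is a finite set of conjunctive queries; a conjunctive query is a finite set of atoms $A(t)$, $t=t'$, $s(t,t')$ with $A$ a concept name, $s$ a role name and $t,t'$ variables or individual names. $\mathcal I$ satisfies a UCQ $Q$ if some $q\in Q$ has a match in $\mathcal I$, i.e. a map from variables to $\Delta^{\mathcal I}$ that makes all atoms of $q$ true. **Entailment modulo types.** The unary $\mathcal K$-type of $d\in\Delta^{\mathcal I}$ is $\{A\in\mathrm{CN}(\mathcal K)\mid d\in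 A^{\mathcal I}\}$. For a set $\Theta$ of subsets of $\mathrm{CN}(\mathcal K)$, we say that $\mathcal I$ realizes only types from $\Theta$ if the unary $\mathcal K$-type of each $d\in\Delta^{\mathcal I}$ belongs to $\Theta$. A *counter-model* is a model of $\mathcal K$ that realizes only types from $\Theta$ and does not satisfy $Q$. We write $\mathcal K\models^{\Theta}_{\mathsf{fin}}Q$ if each finite model of $\mathcal K$ that realizes only types from $\Theta$ satisfies $Q$. **Tree-shaped interpretations.** Let $\mathcal K$ be single-role with role name $r$, and ABox-trivial with individual name $f$. An interpretation is *tree-shaped* if its elements can be arranged into a tree such that $f$ is the root and $r$-edges are allowed only between parents and children; if $\mathcal K$ is an $\mathcal{ALCQ}^+$ KB, moreover, $r$-edges must point from parents to children. It has *bounded degree* if there is $k\in\mathbb N$ such that each element has at most $k$ direct $r$-successors and $r$-predecessors in total. **Lemma.** Let $\mathcal K$ be a single-role, ABox-trivial KB that is either an $\mathcal{ALCI}^+$ KB, or an $\mathcal{ALCQ}^+$ KB without at-most restrictions over $r^*$. Let $Q$ be a plain UCQ and $\Theta$ a set of subsets of $\mathrm{CN}(\mathcal K)$. Then $\mathcal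 K\not\models^{\Theta}_{\mathsf{fin}}Q$ if and only if there exists a tree-shaped counter-model of bounded degree (realizing only types from $\Theta$). -/

import Mathlib

universe u

namespace DL

/-! Vocabulary: countably infinite sets of concept, role and individual names and of variables. -/

abbrev ConceptName : Type := ℕ
abbrev RoleName : Type := ℕ
abbrev IndName : Type := ℕ
abbrev VarName : Type := ℕ

/-! ### Syntax of knowledge bases (without nominals) -/

/-- Concept inclusions in normal form. -/
inductive CI : Type
  /-- `⨅ As ⊑ ⨆ Bs`; the empty conjunction is `⊤`, the empty disjunction is `⊥`. -/
  | bool (As Bs : Finset ConceptName)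
  /-- `A ⊑ (≤ n r B)` -/
  | atMost (A : ConceptName) (n : ℕ) (r : RoleName) (B : ConceptName)
  /-- `A ⊑ (≥ n r B)` -/
  | atLeast (A : ConceptName) (n : ℕ) (r : RoleName) (B : ConceptName)
  /-- `A ⊑ (≤ n r* B)` -/
  | atMostClosure (A : ConceptName) (n : ℕ) (r : RoleName) (B : ConceptName)
  /-- `A ⊑ (≥ n r* B)` -/
  | atLeastClosure (A : ConceptName) (n : ℕ) (r : RoleName) (B : ConceptName)
  /-- `A ⊑ ∀ r⁻. B` -/
  | allInv (A : ConceptName) (r : RoleName) (B : ConceptName)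
  /-- `A ⊑ ∃ r⁻. B` -/
  | exInv (A : ConceptName) (r : RoleName) (B : ConceptName)
  /-- `A ⊑ ∃ (r⁻)*. B` -/
  | exInvClosure (A : ConceptName) (r : RoleName) (B : ConceptName)

/-- ABox assertions `A(a)`, `r(a, b)`, `r*(a, b)`. -/
inductive Assertion : Type
  | concept (A : ConceptName) (a : IndName)
  | role (r : RoleName) (a b : IndName)
  | closure (r : RoleName) (a b : IndName)

/-- A knowledge base: a finite TBox and a finite non-empty ABox. -/
structure KB : Type where
  tbox : Finset CI
  abox : Finset Assertion
  abox_nonempty : abox.Nonempty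

/-- Concept names occurring in a concept inclusion. -/
def CI.conceptNames : CI → Set ConceptName
  | .bool As Bs => {A | A ∈ As ∨ A ∈ Bs}
  | .atMost A _ _ B => {A, B}
  | .atLeast A _ _ B => {A, B}
  | .atMostClosure A _ _ B => {A, B}
  | .atLeastClosure A _ _ B => {A, B}
  | .allInv A _ B => {A, B}
  | .exInv A _ B => {A, B}
  | .exInvClosure A _ B => {A, B}

/-- Role names occurring in a concept inclusion. -/
def CI.roleNames : CI → Set RoleName
  | .bool _ _ => ∅
  | .atMost _ _ r _ => {r}
  | .atLeast _ _ r _ => {r}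
  | .atMostClosure _ _ r _ => {r}
  | .atLeastClosure _ _ r _ => {r}
  | .allInv _ r _ => {r}
  | .exInv _ r _ => {r}
  | .exInvClosure _ r _ => {r}

def Assertion.conceptNames : Assertion → Set ConceptName
  | .concept A _ => {A}
  | .role _ _ _ => ∅
  | .closure _ _ _ => ∅

def Assertion.roleNames : Assertion → Set RoleName
  | .concept _ _ => ∅
  | .role r _ _ => {r}
  | .closure r _ _ => {r}

def Assertion.individuals : Assertion → Set IndName
  | .concept _ a => {a}
  | .role _ a b => {a, b}
  | .closure _ a b => {a, b}

/-- `CN(K)`, the concept names occurring in `K`. -/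
def KB.conceptNames (K : KB) : Set ConceptName :=
  {A | (∃ c ∈ K.tbox, A ∈ c.conceptNames) ∨ ∃ α ∈ K.abox, A ∈ α.conceptNames}

/-- `rol(K)`, the role names occurring in `K`. -/
def KB.roleNames (K : KB) : Set RoleName :=
  {r | (∃ c ∈ K.tbox, r ∈ c.roleNames) ∨ ∃ α ∈ K.abox, r ∈ α.roleNames}

/-- `ind(K)`, the individual names occurring in `K` (there are no nominals, so only the ABox
contributes). -/
def KB.individuals (K : KB) : Set IndName :=
  {a | ∃ α ∈ K.abox, a ∈ α.individuals}

/-! ### Fragments -/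

/-- The inclusion uses no inverse role. -/
def CI.InverseFree : CI → Prop
  | .allInv _ _ _ => False
  | .exInv _ _ _ => False
  | .exInvClosure _ _ _ => False
  | _ => True

/-- The inclusion does not count: the number is `0` in at-most restrictions and `1` in at-least
restrictions. -/
def CI.CountingFree : CI → Prop
  | .atMost _ n _ _ => n = 0
  | .atLeast _ n _ _ => n = 1
  | .atMostClosure _ n _ _ => n = 0
  | .atLeastClosure _ n _ _ => n = 1
  | _ => True

/-- The inclusion is not an at-most restriction over the closure of a role. -/
def CI.NotAtMostClosure : CI → Prop
  | .atMostClosure _ _ _ _ => False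
  | _ => True

/-- `K` is an `ALCI⁺` knowledge base. -/
def KB.IsALCI (K : KB) : Prop := ∀ c ∈ K.tbox, c.CountingFree

/-- `K` is an `ALCQ⁺` knowledge base. -/
def KB.IsALCQ (K : KB) : Prop := ∀ c ∈ K.tbox, c.InverseFree

/-- `K` has no at-most restrictions over closures of roles. -/
def KB.NoAtMostClosure (K : KB) : Prop := ∀ c ∈ K.tbox, c.NotAtMostClosure

/-- No role name other than `r` occurs in `K`. -/
def KB.IsSingleRole (K : KB) (r : RoleName) : Prop := K.roleNames ⊆ {r}

/-- The ABox contains only concept assertions, and a single individual name `f` occurs in it. -/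
def KB.IsABoxTrivial (K : KB) (f : IndName) : Prop :=
  (∀ α ∈ K.abox, ∃ A a, α = Assertion.concept A a) ∧ K.individuals = {f}

/-! ### Interpretations -/

/-- Interpretations. The standard name assumption (`a` is interpreted as itself, for those
individual names `a` that belong to the domain) is rendered by a partial injective map `name`
from individual names to elements: `name a = some d` says that `d` is the element `a`. -/
structure Interp : Type (u + 1) where
  dom : Type u
  nonempty : Nonempty dom
  conc : ConceptName → Set dom
  role : RoleName → dom → dom → Prop
  name : IndName → Option dom
  name_inj : ∀ a b d, name a = some d → name b = some d → a = b

namespace Interp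

/-- The reflexive-transitive closure of the extension of `r`. -/
def closure (I : Interp.{u}) (r : RoleName) : I.dom → I.dom → Prop :=
  Relation.ReflTransGen (I.role r)

def SatCI (I : Interp.{u}) : CI → Prop
  | .bool As Bs => ∀ d, (∀ A ∈ As, d ∈ I.conc A) → ∃ B ∈ Bs, d ∈ I.conc B
  | .atMost A n r B => ∀ d ∈ I.conc A, {e | I.role r d e ∧ e ∈ I.conc B}.encard ≤ n
  | .atLeast A n r B => ∀ d ∈ I.conc A, n ≤ {e | I.role r d e ∧ e ∈ I.conc B}.encard
  | .atMostClosure A n r B => ∀ d ∈ I.conc A, {e | I.closure r d e ∧ e ∈ I.conc B}.encard ≤ n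
  | .atLeastClosure A n r B => ∀ d ∈ I.conc A, n ≤ {e | I.closure r d e ∧ e ∈ I.conc B}.encard
  | .allInv A r B => ∀ d ∈ I.conc A, ∀ e, I.role r e d → e ∈ I.conc B
  | .exInv A r B => ∀ d ∈ I.conc A, ∃ e, I.role r e d ∧ e ∈ I.conc B
  | .exInvClosure A r B => ∀ d ∈ I.conc A, ∃ e, I.closure r e d ∧ e ∈ I.conc B

def SatAssertion (I : Interp.{u}) : Assertion → Prop
  | .concept A a => ∃ d, I.name a = some d ∧ d ∈ I.conc A
  | .role r a b => ∃ d e, I.name a = some d ∧ I.name b = some e ∧ I.role r d e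
  | .closure r a b => ∃ d e, I.name a = some d ∧ I.name b = some e ∧ I.closure r d e

/-- `I` is a model of `K`. -/
def IsModel (I : Interp.{u}) (K : KB) : Prop :=
  (∀ c ∈ K.tbox, I.SatCI c) ∧ ∀ α ∈ K.abox, I.SatAssertion α

/-- The unary `K`-type of `d` in `I`. -/
def unaryType (I : Interp.{u}) (K : KB) (d : I.dom) : Set ConceptName :=
  {A | A ∈ K.conceptNames ∧ d ∈ I.conc A}

/-- `I` realizes only unary `K`-types from `Θ`. -/
def RealizesOnly (I : Interp.{u}) (K : KB) (Θ : Set (Set ConceptName)) : Prop :=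
  ∀ d : I.dom, I.unaryType K d ∈ Θ

end Interp

/-! ### Plain unions of conjunctive queries -/

inductive QTerm : Type
  | var (x : VarName)
  | ind (a : IndName)

/-- Atoms of plain conjunctive queries (no transitive atoms). -/
inductive QAtom : Type
  | concept (A : ConceptName) (t : QTerm)
  | eq (t t' : QTerm)
  | role (r : RoleName) (t t' : QTerm)

/-- Plain conjunctive queries. -/
abbrev CQ : Type := Finset QAtom

/-- Unions of plain conjunctive queries. -/
abbrev UCQ : Type := Finset CQ

namespace Interp

/-- The value of a term under an assignment, if it belongs to the domain. -/
def eval (I : Interp.{u}) (η : VarName → I.dom) : QTerm → Option I.dom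
  | .var x => some (η x)
  | .ind a => I.name a

def SatAtom (I : Interp.{u}) (η : VarName → I.dom) : QAtom → Prop
  | .concept A t => ∃ d, I.eval η t = some d ∧ d ∈ I.conc A
  | .eq t t' => ∃ d, I.eval η t = some d ∧ I.eval η t' = some d
  | .role r t t' => ∃ d e, I.eval η t = some d ∧ I.eval η t' = some e ∧ I.role r d e

/-- There is a match for `q` in `I`. -/
def SatCQ (I : Interp.{u}) (q : CQ) : Prop :=
  ∃ η : VarName → I.dom, ∀ α ∈ q, I.SatAtom η α

def SatUCQ (I : Interp.{u}) (Q : UCQ) : Prop := ∃ q ∈ Q, I.SatCQ q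

/-- `I` is a counter-model for `K` and `Q` modulo `Θ`: a model of `K` that realizes only types
from `Θ` and does not satisfy `Q`. -/
def IsCounterModel (I : Interp.{u}) (K : KB) (Θ : Set (Set ConceptName)) (Q : UCQ) : Prop :=
  I.IsModel K ∧ I.RealizesOnly K Θ ∧ ¬ I.SatUCQ Q

end Interp

/-- `K` finitely entails `Q` modulo `Θ`. -/
def FinEntails (K : KB) (Θ : Set (Set ConceptName)) (Q : UCQ) : Prop :=
  ∀ I : Interp.{u}, Finite I.dom → I.RealizesOnly K Θ → I.IsModel K → I.SatUCQ Q

/-! ### Tree-shaped interpretations -/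

/-- `parent` arranges `α` into a tree rooted at `root`: the root has no parent, and the root is
reached from every element by finitely many steps to the parent. -/
def IsTreeArrangement {α : Type u} (root : α) (parent : α → Option α) : Prop :=
  parent root = none ∧
    ∀ x, Relation.ReflTransGen (fun c p => parent c = some p) x root

namespace Interp

/-- `I` is tree-shaped (for a knowledge base `K` with role name `r` and individual name `f`):
its elements can be arranged into a tree with root `f` such that `r`-edges connect only parents
with children, and point from parents to children if `K` is an `ALCQ⁺` knowledge base. -/
def IsTreeShaped (I : Interp.{u}) (K : KB) (r : RoleName) (f : IndName) : Prop :=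
  ∃ (root : I.dom) (parent : I.dom → Option I.dom),
    I.name f = some root ∧ IsTreeArrangement root parent ∧
    (∀ x y, I.role r x y → parent y = some x ∨ parent x = some y) ∧
    (K.IsALCQ → ∀ x y, I.role r x y → parent y = some x)

/-- The number of direct `r`-successors and `r`-predecessors of an element is bounded. -/
def HasBoundedDegree (I : Interp.{u}) (r : RoleName) : Prop :=
  ∃ k : ℕ, ∀ x, {y | I.role r x y ∨ I.role r y x}.encard ≤ k

end Interp

end DL

namespace DL

/-! ### Foldings of labelled trees -/

section Tree

universe v

variable {α : Type u} {root : α} {parent : α → Option α}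

/-! From a finite counter-model, unravel at `f`, along forward paths for an ALCQ⁺ knowledge base and
along paths in both directions otherwise. The endpoint map is a homomorphism, so no query gains a
match, and required successors lift along it, as do predecessors when backward steps are allowed.
Forward unravelling also preserves successor counts (`injOn_unravelProj_succ`).

Conversely, a tree has to be made finite without creating query matches. Let `N` bound the number of
terms in a query of `Q`. Cut the tree above all levels of one residue class modulo `N + 1`. The
slabs between cuts have bounded height and finitely many labels, so the tree folds onto finitely
many of its nodes, breaking only edges across cuts (`exists_fold`). Now identify nodes that agree in
label, in level modulo `N + 1` and in their images under all `N + 1` folds. A query matched after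
this identification uses at most `N` residues, so the cuts of some fold avoid it, and that fold
carries the match back into the tree (`satUCQ_of_folding`).

Without counting, the quotient is already a model, as labels record which concept names are
reachable. With counting, a quotient may merge siblings or give a class the successors of several
nodes. Instead, finite pieces of height `H` are copied below representatives of the classes, and an
edge leaving a piece at `e` is redirected to the top of the piece below the representative of `e`.
This preserves successor counts (`encard_unfolding_succ`), and for large `H` each piece holds enough
witnesses for at-least restrictions over `r*` (`le_encard_unfolding_closure`). Upper bounds on
reachable elements need not survive, hence their exclusion. -/

theorem IsTreeArrangement.wellFounded (h : IsTreeArrangement root parent) :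
    WellFounded fun p c => parent c = some p := by
  refine ⟨fun x => ?_⟩
  induction h.2 x using Relation.ReflTransGen.head_induction_on with
  | refl => exact ⟨_, fun p hp => by simp [h.1] at hp⟩
  | head hcp _ ih =>
    refine ⟨_, fun q hq => ?_⟩
    rw [hcp] at hq
    cases hq
    exact ih

/-- Functions on a tree can be defined by recursion from parents to children. -/
theorem IsTreeArrangement.exists_rec (h : IsTreeArrangement root parent) {β : Type v}
    (a : α → β) (g : α → α → β → β) :
    ∃ F : α → β, (∀ c, parent c = none → F c = a c) ∧
      ∀ p c, parent c = some p → F c = g p c (F p) := by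
  let G : ∀ c, (∀ p, parent c = some p → β) → β := fun c ih =>
    match hc : parent c with
    | none => a c
    | some p => g p c (ih p hc)
  refine ⟨h.wellFounded.fix G, fun c hc => ?_, fun p c hc => ?_⟩
  · rw [WellFounded.fix_eq]
    simp only [G]
    split
    · rfl
    · simp_all
  · rw [WellFounded.fix_eq]
    simp only [G]
    split
    · simp_all
    · rename_i q hq
      rw [hc] at hq
      cases hq
      rfl

theorem IsTreeArrangement.exists_depth (h : IsTreeArrangement root parent) :
    ∃ depth : α → ℕ, ∀ p c, parent c = some p → depth c = depth p + 1 :=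
  let ⟨F, _, hF⟩ := h.exists_rec (fun _ => 0) (fun _ _ n => n + 1)
  ⟨F, hF⟩

/-- Types of nodes of a labelled tree up to depth `n` (and up to multiplicities). -/
def TreeType (L : Type v) : ℕ → Type v
  | 0 => L
  | n + 1 => L × Set (TreeType L n)

theorem TreeType.finite (L : Type v) [Finite L] : ∀ n, Finite (TreeType L n)
  | 0 => ‹Finite L›
  | n + 1 => by
    have := TreeType.finite L n
    exact inferInstanceAs (Finite (L × Set (TreeType L n)))

variable {L : Type v} {lab : α → L}

/-- The type of a node up to depth `n`. -/
def treeType (parent : α → Option α) (lab : α → L) : ∀ n, α → TreeType L n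
  | 0, d => lab d
  | n + 1, d => (lab d, {t | ∃ e, parent e = some d ∧ treeType parent lab n e = t})

theorem lab_eq_of_treeType_eq {n : ℕ} {d d' : α}
    (h : treeType parent lab n d = treeType parent lab n d') : lab d = lab d' := by
  cases n with
  | zero => exact h
  | succ n => exact congrArg Prod.fst h

theorem exists_child_of_treeType_eq {n : ℕ} {d d' e : α}
    (h : treeType parent lab (n + 1) d = treeType parent lab (n + 1) d')
    (he : parent e = some d) :
    ∃ e', parent e' = some d' ∧ treeType parent lab n e' = treeType parent lab n e := by
  have h2 : {t | ∃ e, parent e = some d ∧ treeType parent lab n e = t} =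
    {t | ∃ e, parent e = some d' ∧ treeType parent lab n e = t} := congrArg Prod.snd h
  have : treeType parent lab n e ∈ {t | ∃ e, parent e = some d ∧ treeType parent lab n e = t} :=
    ⟨e, he, rfl⟩
  rw [h2] at this
  exact this

/-- Adding 1 to a residue wraps around only at `N`, where the result is 0; `hb` excludes this. -/
theorem zmod_val_succ {N : ℕ} {a b : ZMod (N + 1)} (h : b = a + 1) (hb : b ≠ 0) :
    b.val = a.val + 1 := by
  subst h
  have h1 : a.val < N + 1 := a.val_lt
  have h2 : ((a.val + 1 : ℕ) : ZMod (N + 1)) = a + 1 := by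
    rw [Nat.cast_add, ZMod.natCast_zmod_val, Nat.cast_one]
  rcases Nat.lt_succ_iff_lt_or_eq.1 h1 with h3 | h3
  · rw [← h2, ZMod.val_natCast_of_lt (by omega)]
  · rw [h3, ZMod.natCast_self] at h2
    exact absurd h2.symm hb

/-- A tree with finitely many labels can be mapped to finitely many of its nodes, preserving labels
and all edges except those that enter a level congruent to `-s` modulo `N + 1`. -/
theorem IsTreeArrangement.exists_fold (h : IsTreeArrangement root parent) [Finite L]
    (lab : α → L) (depth : α → ℕ) (hdepth : ∀ p c, parent c = some p → depth c = depth p + 1)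
    {N : ℕ} (s : ZMod (N + 1)) :
    ∃ φ : α → α, (Set.range φ).Finite ∧ (∀ d, lab (φ d) = lab d) ∧
      ∀ p e, parent e = some p → (depth e : ZMod (N + 1)) + s ≠ 0 →
        parent (φ e) = some (φ p) := by
  classical
  have : Nonempty α := ⟨root⟩
  have := TreeType.finite L
  -- `o d` is the position of `d` within its slab, with 0 just below a cut; `b d` is the number of
  -- levels left in the slab, and hence the depth to which the type of `d` must be preserved.
  let o : α → ZMod (N + 1) := fun d => (depth d : ZMod (N + 1)) + s
  let b : α → ℕ := fun d => N - (o d).val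
  let rep : ∀ n, TreeType L n → α := fun n => Function.invFun (treeType parent lab n)
  -- The default `root` is never reached in the construction: the invariant below guarantees a
  -- suitable child.
  let pick : ∀ n, α → TreeType L n → α := fun n y t =>
    if hc : ∃ e', parent e' = some y ∧ treeType parent lab n e' = t then hc.choose else root
  have hrep : ∀ n d, treeType parent lab n (rep n (treeType parent lab n d)) =
      treeType parent lab n d := fun n d => Function.invFun_eq ⟨d, rfl⟩
  obtain ⟨φ, hφ0, hφ⟩ := h.exists_rec (fun c => rep (b c) (treeType parent lab (b c) c))
    (fun p c y => if o c = 0 then rep (b c) (treeType parent lab (b c) c)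
      else pick (b c) y (treeType parent lab (b c) c))
  have hval : ∀ p c, parent c = some p → o c ≠ 0 → (o c).val = (o p).val + 1 := by
    intro p c hpc hc
    refine zmod_val_succ ?_ hc
    simp only [o, hdepth p c hpc]
    push_cast
    ring
  have hb : ∀ p c, parent c = some p → o c ≠ 0 → b p = b c + 1 := by
    intro p c hpc hc
    have h1 := hval p c hpc hc
    have h2 : (o c).val < N + 1 := (o c).val_lt
    simp only [b]
    omega
  -- The image has the type of `d` up to depth `b d`. Since `b` drops by one along an uncut edge,
  -- the type of the image of the parent provides a child of the type required next.
  have hinv : ∀ d, treeType parent lab (b d) (φ d) = treeType parent lab (b d) d ∧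
      ∀ p, parent d = some p → o d ≠ 0 → parent (φ d) = some (φ p) := by
    intro d
    induction d using h.wellFounded.induction with
    | _ d ih =>
    rcases hd : parent d with _ | p
    · rw [hφ0 d hd]
      exact ⟨hrep _ _, by simp⟩
    · rw [hφ p d hd]
      by_cases hc : o d = 0
      · simp only [hc, if_true]
        exact ⟨hrep _ _, fun _ _ hne => absurd rfl hne⟩
      · have hp := (ih p hd).1
        rw [hb p d hd hc] at hp
        have hex := exists_child_of_treeType_eq hp.symm hd
        have hpk : pick (b d) (φ p) (treeType parent lab (b d) d) = hex.choose := dif_pos hex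
        simp only [hc, if_false, hpk]
        refine ⟨hex.choose_spec.2, fun q hq _ => ?_⟩
        cases hq
        exact hex.choose_spec.1
  refine ⟨φ, ?_, fun d => lab_eq_of_treeType_eq (hinv d).1, fun p e he hs => (hinv e).2 p he hs⟩
  -- Induction on the position in the slab: an image is either chosen afresh by one of finitely many
  -- types (at a cut, or at the parentless node), or picked by such a type below one of finitely
  -- many earlier images.
  have hfin : ∀ i, (φ '' {d | (o d).val = i}).Finite := by
    intro i
    induction i with
    | zero =>
      refine (Set.finite_range (rep N)).subset ?_
      rintro _ ⟨d, hd, rfl⟩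
      have hd0 : o d = 0 := (ZMod.val_eq_zero _).1 hd
      have hbd : b d = N := by simp only [b, hd0, ZMod.val_zero, Nat.sub_zero]
      rcases hpd : parent d with _ | p
      · rw [hφ0 d hpd, hbd]
        exact ⟨_, rfl⟩
      · rw [hφ p d hpd, if_pos hd0, hbd]
        exact ⟨_, rfl⟩
    | succ i ih =>
      refine ((Set.finite_range (rep (N - (i + 1)))).union
        (ih.biUnion fun y _ => Set.finite_range (pick (N - (i + 1)) y))).subset ?_
      rintro _ ⟨d, hd, rfl⟩
      have hd' : (o d).val = i + 1 := hd
      have hd0 : o d ≠ 0 := fun h0 => by simp [h0] at hd'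
      have hbd : b d = N - (i + 1) := by simp only [b, hd']
      rcases hpd : parent d with _ | p
      · rw [hφ0 d hpd, hbd]
        exact Or.inl ⟨_, rfl⟩
      · rw [hφ p d hpd, if_neg hd0, hbd]
        refine Or.inr (Set.mem_biUnion (x := φ p) ⟨p, ?_, rfl⟩ ⟨_, rfl⟩)
        have := hval p d hpd hd0
        change (o p).val = i
        omega
  refine ((Set.finite_Iio (N + 1)).biUnion fun i _ => hfin i).subset ?_
  rintro _ ⟨d, rfl⟩
  exact Set.mem_biUnion (x := (o d).val) (o d).val_lt ⟨d, rfl, rfl⟩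

/-- An equivalence of finite index on the nodes of a labelled tree, whose quotient can locally be
mapped back to the tree. -/
structure Folding (parent : α → Option α) (lab : α → L) (N : ℕ) where
  depth : α → ℕ
  depth_child : ∀ p c, parent c = some p → depth c = depth p + 1
  equiv : Setoid α
  finite_quotient : Finite (Quotient equiv)
  lab_congr : ∀ {d d'}, equiv d d' → lab d = lab d'
  depth_congr : ∀ {d d'}, equiv d d' → (depth d : ZMod (N + 1)) = depth d'
  map : ZMod (N + 1) → α → α
  map_congr : ∀ s {d d'}, equiv d d' → map s d = map s d'
  lab_map : ∀ s d, lab (map s d) = lab d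
  parent_map : ∀ s p e, parent e = some p → (depth e : ZMod (N + 1)) + s ≠ 0 →
    parent (map s e) = some (map s p)

/-- Label, residue of the depth and images under all folds form a single map into a finite type. Its
kernel has finite index, and every fold factors through it. -/
theorem IsTreeArrangement.exists_folding (h : IsTreeArrangement root parent) [Finite L]
    (lab : α → L) (N : ℕ) : Nonempty (Folding parent lab N) := by
  obtain ⟨depth, hdepth⟩ := h.exists_depth
  choose φ hfin hlab hpar using fun s : ZMod (N + 1) => h.exists_fold lab depth hdepth s
  have := fun s => (hfin s).to_subtype
  let F : α → L × ZMod (N + 1) × ∀ s : ZMod (N + 1), Set.range (φ s) :=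
    fun d => (lab d, (depth d : ZMod (N + 1)), fun s => ⟨φ s d, d, rfl⟩)
  exact ⟨{
    depth := depth
    depth_child := hdepth
    equiv := Setoid.ker F
    finite_quotient := Finite.of_injective _ (Setoid.kerLift_injective F)
    lab_congr := fun hE => congrArg Prod.fst (Setoid.ker_def.1 hE)
    depth_congr := fun hE => congrArg (fun x => x.2.1) (Setoid.ker_def.1 hE)
    map := φ
    map_congr := fun s _ _ hE => congrArg (fun x => (x.2.2 s : α)) (Setoid.ker_def.1 hE)
    lab_map := hlab
    parent_map := hpar }⟩

end Tree

/-! ### Names in knowledge bases and terms in queries -/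

theorem CI.finite_conceptNames (c : CI) : c.conceptNames.Finite := by
  cases c with
  | bool As Bs =>
    exact (As.finite_toSet.union Bs.finite_toSet).subset fun A hA => hA
  | _ => exact (Set.finite_singleton _).insert _

theorem Assertion.finite_conceptNames (α : Assertion) : α.conceptNames.Finite := by
  cases α with
  | concept A a => exact Set.finite_singleton _
  | _ => exact Set.finite_empty

theorem KB.finite_conceptNames (K : KB) : K.conceptNames.Finite := by
  refine ((K.tbox.finite_toSet.biUnion fun c _ => c.finite_conceptNames).union
    (K.abox.finite_toSet.biUnion fun α _ => α.finite_conceptNames)).subset ?_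
  rintro A (⟨c, hc, hA⟩ | ⟨α, hα, hA⟩)
  · exact Or.inl (Set.mem_biUnion (x := c) hc hA)
  · exact Or.inr (Set.mem_biUnion (x := α) hα hA)

theorem KB.mem_conceptNames {K : KB} {c : CI} (hc : c ∈ K.tbox) {A : ConceptName}
    (hA : A ∈ c.conceptNames) : A ∈ K.conceptNames := Or.inl ⟨c, hc, hA⟩

theorem KB.IsSingleRole.eq {K : KB} {r s : RoleName} (h : K.IsSingleRole r) {c : CI}
    (hc : c ∈ K.tbox) (hs : s ∈ c.roleNames) : s = r := h (Or.inl ⟨c, hc, hs⟩)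

/-- The ABox of an ABox-trivial knowledge base consists of assertions `A(f)`. -/
theorem KB.IsABoxTrivial.eq_concept {K : KB} {f : IndName} (h : K.IsABoxTrivial f) {α : Assertion}
    (hα : α ∈ K.abox) : ∃ A ∈ K.conceptNames, α = Assertion.concept A f := by
  obtain ⟨A, a, rfl⟩ := h.1 α hα
  have ha : a ∈ K.individuals := ⟨_, hα, rfl⟩
  rw [h.2] at ha
  cases ha
  exact ⟨A, Or.inr ⟨_, hα, rfl⟩, rfl⟩

open Classical in
/-- The terms occurring in an atom. -/
noncomputable def QAtom.terms : QAtom → Finset QTerm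
  | .concept _ t => {t}
  | .eq t t' => {t, t'}
  | .role _ t t' => {t, t'}

open Classical in
/-- The terms occurring in a conjunctive query. -/
noncomputable def CQ.terms (q : CQ) : Finset QTerm := q.biUnion QAtom.terms

open Classical in
theorem CQ.mem_terms {q : CQ} {α : QAtom} (hα : α ∈ q) {t : QTerm} (ht : t ∈ α.terms) :
    t ∈ CQ.terms q := Finset.mem_biUnion.2 ⟨α, hα, ht⟩

/-- A bound on the number of terms in the queries of a union. -/
noncomputable def UCQ.size (Q : UCQ) : ℕ := Q.sup fun q => (CQ.terms q).card

/-! ### Node labels and transfer of query matches along foldings -/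

namespace Interp

/-- The label of a node of a tree-shaped interpretation: whether it is the root, its concept names,
the edges that connect it with its parent, and the numbers, up to `M`, of reachable instances of
concept names. -/
def nodeLabel (I : Interp.{u}) (K : KB) (r : RoleName) (root : I.dom)
    (parent : I.dom → Option I.dom) (M : ℕ) (d : I.dom) :
    Prop × Set K.conceptNames × Prop × Prop × Set (K.conceptNames × Fin (M + 1)) :=
  (d = root, {A | d ∈ I.conc A}, (∃ p, parent d = some p ∧ I.role r p d),
    (∃ p, parent d = some p ∧ I.role r d p),
    {x | ((x.2 : ℕ) : ℕ∞) ≤ {e | I.closure r d e ∧ e ∈ I.conc x.1}.encard})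

section Label

variable {I : Interp.{u}} {K : KB} {r : RoleName} {root : I.dom}
  {parent : I.dom → Option I.dom} {M : ℕ} {d d' : I.dom}

theorem eq_root_iff_of_nodeLabel_eq
    (h : I.nodeLabel K r root parent M d = I.nodeLabel K r root parent M d') :
    d = root ↔ d' = root := Eq.to_iff (congrArg Prod.fst h)

theorem mem_conc_iff_of_nodeLabel_eq
    (h : I.nodeLabel K r root parent M d = I.nodeLabel K r root parent M d')
    {A : ConceptName} (hA : A ∈ K.conceptNames) : d ∈ I.conc A ↔ d' ∈ I.conc A :=
  Set.ext_iff.1 (congrArg (fun x => x.2.1) h) ⟨A, hA⟩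

theorem role_parent_iff_of_nodeLabel_eq
    (h : I.nodeLabel K r root parent M d = I.nodeLabel K r root parent M d')
    {p p' : I.dom} (hp : parent d = some p) (hp' : parent d' = some p') :
    (I.role r p d ↔ I.role r p' d') ∧ (I.role r d p ↔ I.role r d' p') := by
  have h1 := Eq.to_iff (congrArg (fun x => x.2.2.1) h)
  have h2 := Eq.to_iff (congrArg (fun x => x.2.2.2.1) h)
  simpa [nodeLabel, hp, hp'] using And.intro h1 h2

theorem le_encard_iff_of_nodeLabel_eq
    (h : I.nodeLabel K r root parent M d = I.nodeLabel K r root parent M d')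
    {A : ConceptName} (hA : A ∈ K.conceptNames) {m : ℕ} (hm : m ≤ M) :
    (m : ℕ∞) ≤ {e | I.closure r d e ∧ e ∈ I.conc A}.encard ↔
      (m : ℕ∞) ≤ {e | I.closure r d' e ∧ e ∈ I.conc A}.encard :=
  Set.ext_iff.1 (congrArg (fun x => x.2.2.2.2) h) (⟨A, hA⟩, ⟨m, Nat.lt_succ_of_le hm⟩)

end Label

/-- If the edges of `J` come from edges of a tree-shaped `I` up to a folding, then each query that
has a match in `J` has one in `I`. -/
theorem satUCQ_of_folding {I J : Interp.{u}} {K : KB} {r : RoleName} {f : IndName} {root : I.dom}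
    {parent : I.dom → Option I.dom} {M : ℕ} {Q : UCQ} (hroot : I.name f = some root)
    (hedge : ∀ x y, I.role r x y → parent y = some x ∨ parent x = some y)
    (F : Folding parent (I.nodeLabel K r root parent M) Q.size) (π : J.dom → I.dom)
    (hconc : ∀ A x, x ∈ J.conc A → A ∈ K.conceptNames ∧ π x ∈ I.conc A)
    (hrole : ∀ s x y, J.role s x y →
      s = r ∧ ∃ d e, F.equiv d (π x) ∧ F.equiv e (π y) ∧ I.role r d e)
    (hname : ∀ a x, J.name a = some x → a = f ∧ π x = root) (hJ : J.SatUCQ Q) :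
    I.SatUCQ Q := by
  classical
  obtain ⟨q, hq, η, hη⟩ := hJ
  obtain ⟨x₀⟩ := J.nonempty
  let val : QTerm → J.dom := fun t => (J.eval η t).getD x₀
  have hval : ∀ {t x}, J.eval η t = some x → val t = x := fun {t x} h => by simp [val, h]
  let dep : J.dom → ZMod (Q.size + 1) := fun x => (F.depth (π x) : ZMod (Q.size + 1))
  -- Pigeonhole: there are `Q.size + 1` residues and at most `Q.size` terms, so some `s` has its
  -- cuts at levels that contain no matched term.
  obtain ⟨s, hs⟩ : ∃ s : ZMod (Q.size + 1), s ∉ (CQ.terms q).image fun t => -dep (val t) := by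
    by_contra! hall
    have h1 : (Finset.univ : Finset (ZMod (Q.size + 1))) ⊆
        (CQ.terms q).image fun t => -dep (val t) := fun s _ => hall s
    have h2 := (Finset.card_le_card h1).trans Finset.card_image_le
    rw [Finset.card_univ, ZMod.card] at h2
    have h3 : (CQ.terms q).card ≤ Q.size := Finset.le_sup (f := fun q => (CQ.terms q).card) hq
    omega
  have hs' : ∀ {α t x}, α ∈ q → t ∈ QAtom.terms α → J.eval η t = some x → dep x + s ≠ 0 := by
    intro α t x hα ht hx h0
    refine hs (Finset.mem_image.2 ⟨t, CQ.mem_terms hα ht, ?_⟩)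
    rw [hval hx]
    exact neg_eq_of_add_eq_zero_right h0
  let θ : J.dom → I.dom := fun x => F.map s (π x)
  have heval : ∀ {t x}, J.eval η t = some x → I.eval (fun v => θ (η v)) t = some (θ x) := by
    intro t x h
    cases t with
    | var v => cases h; rfl
    | ind a =>
      obtain ⟨rfl, hx⟩ := hname a x h
      have : θ x = root := (eq_root_iff_of_nodeLabel_eq (F.lab_map s (π x))).2 hx
      rw [this]
      exact hroot
  have hθconc : ∀ {A x}, x ∈ J.conc A → θ x ∈ I.conc A := by
    intro A x hx
    obtain ⟨hA, hx⟩ := hconc A x hx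
    exact (mem_conc_iff_of_nodeLabel_eq (F.lab_map s (π x)) hA).2 hx
  have hθrole : ∀ {p x y}, J.role p x y → dep x + s ≠ 0 → dep y + s ≠ 0 →
      I.role p (θ x) (θ y) := by
    intro p x y hxy hx hy
    obtain ⟨rfl, d, e, hd, he, hde⟩ := hrole p x y hxy
    change I.role p (F.map s (π x)) (F.map s (π y))
    -- The fold does not distinguish equivalent elements, so the edge may be transported at its
    -- witnesses `d`, `e` in the tree; it is uncut because its lower end is not at a cut level.
    rw [← F.map_congr s hd, ← F.map_congr s he]
    simp only [dep, ← F.depth_congr hd, ← F.depth_congr he] at hx hy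
    rcases hedge d e hde with h | h
    · exact (role_parent_iff_of_nodeLabel_eq (F.lab_map s e) (F.parent_map s d e h hy) h).1.2 hde
    · exact (role_parent_iff_of_nodeLabel_eq (F.lab_map s d) (F.parent_map s e d h hx) h).2.2 hde
  refine ⟨q, hq, fun v => θ (η v), fun α hα => ?_⟩
  have hsat := hη α hα
  cases α with
  | concept A t =>
    obtain ⟨x, hx, hA⟩ := hsat
    exact ⟨θ x, heval hx, hθconc hA⟩
  | eq t t' =>
    obtain ⟨x, hx, hx'⟩ := hsat
    exact ⟨θ x, heval hx, heval hx'⟩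
  | role p t t' =>
    obtain ⟨x, y, hx, hy, hxy⟩ := hsat
    exact ⟨θ x, θ y, heval hx, heval hy, hθrole hxy
      (hs' hα (by simp [QAtom.terms]) hx) (hs' hα (by simp [QAtom.terms]) hy)⟩

/-! ### Finite quotients for ALCI⁺ -/

/-- The quotient of an interpretation, restricted to the names of `K`, `r`, and `f`. -/
def quotient (I : Interp.{u}) (K : KB) (r : RoleName) (f : IndName) (root : I.dom)
    (E : Setoid I.dom) : Interp.{u} where
  dom := Quotient E
  nonempty := ⟨Quotient.mk E root⟩
  conc A := {x | A ∈ K.conceptNames ∧ ∃ d, Quotient.mk E d = x ∧ d ∈ I.conc A}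
  role s x y := s = r ∧ ∃ d e, Quotient.mk E d = x ∧ Quotient.mk E e = y ∧ I.role r d e
  name a := open Classical in if a = f then some (Quotient.mk E root) else none
  name_inj := by
    intro a b d ha hb
    split_ifs at ha hb
    simp_all

/-- A tree-shaped counter-model of an `ALCI⁺` knowledge base has a finite quotient that is a
counter-model. -/
theorem IsCounterModel.quotient {I : Interp.{u}} {K : KB} {r : RoleName} {f : IndName}
    {Θ : Set (Set ConceptName)} {Q : UCQ} {root : I.dom} {parent : I.dom → Option I.dom}
    (hI : I.IsCounterModel K Θ Q) (hK : K.IsALCI) (hr : K.IsSingleRole r)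
    (hf : K.IsABoxTrivial f) (hroot : I.name f = some root)
    (hedge : ∀ x y, I.role r x y → parent y = some x ∨ parent x = some y)
    (F : Folding parent (I.nodeLabel K r root parent 1) Q.size) :
    (I.quotient K r f root F.equiv).IsCounterModel K Θ Q := by
  obtain ⟨⟨htbox, habox⟩, hΘ, hQ⟩ := hI
  set J := I.quotient K r f root F.equiv with hJ
  let mk : I.dom → J.dom := Quotient.mk F.equiv
  have hout : ∀ x : J.dom, ∃ d, mk d = x := Quotient.exists_rep
  have hmk : ∀ {d d'}, mk d = mk d' → F.equiv d d' := fun h => Quotient.exact h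
  have hconc : ∀ {A d}, A ∈ K.conceptNames → (mk d ∈ J.conc A ↔ d ∈ I.conc A) := by
    intro A d hA
    constructor
    · rintro ⟨-, d', hd', h⟩
      exact (mem_conc_iff_of_nodeLabel_eq (F.lab_congr (hmk hd')) hA).1 h
    · exact fun h => ⟨hA, d, rfl, h⟩
  have hrole : ∀ {d e}, I.role r d e → J.role r (mk d) (mk e) :=
    fun h => ⟨rfl, _, _, rfl, rfl, h⟩
  have hclos : ∀ {d e}, I.closure r d e → J.closure r (mk d) (mk e) :=
    fun h => Relation.ReflTransGen.lift mk (fun _ _ => hrole) _ _ h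
  -- A path in the quotient need not lift to one path of the tree, as consecutive edges may meet in
  -- different members of a class. But the members share a label, which tells whether an instance of
  -- `B` is reachable, so reachability is passed back edge by edge.
  have hreach : ∀ {B x y}, B ∈ K.conceptNames → J.closure r x y → y ∈ J.conc B →
      ∀ d, mk d = x → ∃ e, I.closure r d e ∧ e ∈ I.conc B := by
    intro B x y hB hxy hy
    induction hxy using Relation.ReflTransGen.head_induction_on with
    | refl =>
      rintro d rfl
      exact ⟨d, .refl, (hconc hB).1 hy⟩
    | head hxz _ ih =>
      rintro d rfl
      obtain ⟨-, d', e', hd', he', hde⟩ := hxz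
      obtain ⟨e, he, heB⟩ := ih e' he'
      have h1 := (le_encard_iff_of_nodeLabel_eq (F.lab_congr (hmk hd')) hB (le_refl 1)).1
        (by rw [Nat.cast_one, Set.one_le_encard_iff_nonempty]; exact ⟨e, .head hde he, heB⟩)
      rwa [Nat.cast_one, Set.one_le_encard_iff_nonempty] at h1
  refine ⟨⟨fun c hc => ?_, fun α hα => ?_⟩, fun x => ?_, fun hJQ => hQ ?_⟩
  · have hcI := htbox c hc
    have hcount := hK c hc
    have hCN := fun {A} (hA : A ∈ c.conceptNames) => KB.mem_conceptNames hc hA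
    cases c with
    | bool As Bs =>
      intro x hx
      obtain ⟨d, rfl⟩ := hout x
      obtain ⟨B, hB, hdB⟩ := hcI d fun A hA => (hconc (hCN (Or.inl hA))).1 (hx A hA)
      exact ⟨B, hB, (hconc (hCN (Or.inr hB))).2 hdB⟩
    | atMost A n s B =>
      obtain rfl : s = r := hr.eq hc rfl
      obtain rfl : n = 0 := hcount
      intro x hx
      simp only [Nat.cast_zero, nonpos_iff_eq_zero, Set.encard_eq_zero,
        Set.eq_empty_iff_forall_notMem]
      rintro y ⟨⟨-, d, e, rfl, rfl, hde⟩, hyB⟩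
      have := hcI d ((hconc (hCN (Or.inl rfl))).1 hx)
      simp only [Nat.cast_zero, nonpos_iff_eq_zero, Set.encard_eq_zero,
        Set.eq_empty_iff_forall_notMem] at this
      exact this e ⟨hde, (hconc (hCN (Or.inr rfl))).1 hyB⟩
    | atLeast A n s B =>
      obtain rfl : s = r := hr.eq hc rfl
      obtain rfl : n = 1 := hcount
      intro x hx
      obtain ⟨d, rfl⟩ := hout x
      have := hcI d ((hconc (hCN (Or.inl rfl))).1 hx)
      rw [Nat.cast_one, Set.one_le_encard_iff_nonempty] at this ⊢
      obtain ⟨e, he, heB⟩ := this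
      exact ⟨mk e, hrole he, (hconc (hCN (Or.inr rfl))).2 heB⟩
    | atMostClosure A n s B =>
      obtain rfl : s = r := hr.eq hc rfl
      obtain rfl : n = 0 := hcount
      intro x hx
      obtain ⟨d, rfl⟩ := hout x
      have := hcI d ((hconc (hCN (Or.inl rfl))).1 hx)
      simp only [Nat.cast_zero, nonpos_iff_eq_zero, Set.encard_eq_zero,
        Set.eq_empty_iff_forall_notMem] at this ⊢
      rintro y ⟨hxy, hyB⟩
      obtain ⟨e, he⟩ := hreach (hCN (Or.inr rfl)) hxy hyB d rfl
      exact this e he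
    | atLeastClosure A n s B =>
      obtain rfl : s = r := hr.eq hc rfl
      obtain rfl : n = 1 := hcount
      intro x hx
      obtain ⟨d, rfl⟩ := hout x
      have := hcI d ((hconc (hCN (Or.inl rfl))).1 hx)
      rw [Nat.cast_one, Set.one_le_encard_iff_nonempty] at this ⊢
      obtain ⟨e, he, heB⟩ := this
      exact ⟨mk e, hclos he, (hconc (hCN (Or.inr rfl))).2 heB⟩
    | allInv A s B =>
      obtain rfl : s = r := hr.eq hc rfl
      rintro x hx y ⟨-, d, e, rfl, rfl, hde⟩
      exact (hconc (hCN (Or.inr rfl))).2 (hcI e ((hconc (hCN (Or.inl rfl))).1 hx) d hde)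
    | exInv A s B =>
      obtain rfl : s = r := hr.eq hc rfl
      intro x hx
      obtain ⟨d, rfl⟩ := hout x
      obtain ⟨e, he, heB⟩ := hcI d ((hconc (hCN (Or.inl rfl))).1 hx)
      exact ⟨mk e, hrole he, (hconc (hCN (Or.inr rfl))).2 heB⟩
    | exInvClosure A s B =>
      obtain rfl : s = r := hr.eq hc rfl
      intro x hx
      obtain ⟨d, rfl⟩ := hout x
      obtain ⟨e, he, heB⟩ := hcI d ((hconc (hCN (Or.inl rfl))).1 hx)
      exact ⟨mk e, hclos he, (hconc (hCN (Or.inr rfl))).2 heB⟩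
  · obtain ⟨A, hA, rfl⟩ := hf.eq_concept hα
    obtain ⟨d, hd, hdA⟩ := habox _ hα
    rw [hroot] at hd
    cases hd
    exact ⟨mk root, if_pos rfl, (hconc hA).2 hdA⟩
  · obtain ⟨d, rfl⟩ := hout x
    have : J.unaryType K (mk d) = I.unaryType K d := by
      ext A
      exact and_congr_right fun hA => hconc hA
    rw [this]
    exact hΘ d
  · choose π hπ using hout
    have hπE : ∀ d, F.equiv (π (mk d)) d := fun d => hmk (hπ _)
    refine satUCQ_of_folding hroot hedge F π ?_ ?_ ?_ hJQ
    · intro A x hx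
      refine ⟨hx.1, (hconc hx.1).1 ?_⟩
      rwa [hπ]
    · rintro s x y ⟨rfl, d, e, rfl, rfl, hde⟩
      exact ⟨rfl, d, e, F.equiv.symm (hπE d), F.equiv.symm (hπE e), hde⟩
    · intro a x hx
      by_cases ha : a = f
      · have hx' : some (mk root) = some x := by
          rw [← hx]
          exact (if_pos ha).symm
        cases hx'
        exact ⟨ha, (eq_root_iff_of_nodeLabel_eq (F.lab_congr (hπE root))).2 rfl⟩
      · have hx' : none = some x := by
          rw [← hx]
          exact (if_neg ha).symm
        cases hx'

/-! ### Finite unfoldings for ALCQ⁺ -/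

/-- The elements reachable from `t` that lie less than `H` levels below `t`. -/
def piece (I : Interp.{u}) (r : RoleName) (depth : I.dom → ℕ) (H : ℕ) (t : I.dom) : Set I.dom :=
  {u | I.closure r t u ∧ depth u < depth t + H}

/-- The elements reachable from `t` that lie exactly `H` levels below `t`. -/
def frontier (I : Interp.{u}) (r : RoleName) (depth : I.dom → ℕ) (H : ℕ) (t : I.dom) :
    Set I.dom :=
  {u | I.closure r t u ∧ depth u = depth t + H}

section Directed

variable {I : Interp.{u}} {r : RoleName} {depth : I.dom → ℕ}

theorem depth_le_of_closure (hdepth : ∀ x y, I.role r x y → depth y = depth x + 1) {x y : I.dom}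
    (h : I.closure r x y) : depth x ≤ depth y := by
  induction h with
  | refl => exact le_rfl
  | tail _ hyz ih => exact ih.trans (by rw [hdepth _ _ hyz]; exact Nat.le_succ _)

theorem finite_frontier (hdepth : ∀ x y, I.role r x y → depth y = depth x + 1)
    (hfin : ∀ x, {y | I.role r x y}.Finite) (H : ℕ) (t : I.dom) :
    (I.frontier r depth H t).Finite := by
  induction H with
  | zero =>
    refine (Set.finite_singleton t).subset ?_
    rintro u ⟨hu, hd⟩
    rcases Relation.ReflTransGen.cases_tail hu with h | ⟨v, hv, hvu⟩
    · exact h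
    · have h1 := depth_le_of_closure hdepth hv
      have h2 := hdepth v u hvu
      omega
  | succ H ih =>
    refine (ih.biUnion fun v _ => hfin v).subset ?_
    rintro u ⟨hu, hd⟩
    rcases Relation.ReflTransGen.cases_tail hu with h | ⟨v, hv, hvu⟩
    · subst h
      omega
    · have h2 := hdepth v u hvu
      exact Set.mem_biUnion (x := v) ⟨hv, by omega⟩ hvu

theorem finite_piece (hdepth : ∀ x y, I.role r x y → depth y = depth x + 1)
    (hfin : ∀ x, {y | I.role r x y}.Finite) (H : ℕ) (t : I.dom) :
    (I.piece r depth H t).Finite := by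
  refine ((Set.finite_Iio H).biUnion fun i _ => finite_frontier hdepth hfin i t).subset ?_
  rintro u ⟨hu, hd⟩
  have h1 := depth_le_of_closure hdepth hu
  exact Set.mem_biUnion (x := depth u - depth t) (by simp only [Set.mem_Iio]; omega)
    ⟨hu, by omega⟩

/-- Any `m` witnesses form a finite set and so lie at bounded depth. -/
theorem eventually_le_encard_piece (t : I.dom) (S : Set I.dom) (m : ℕ)
    (h : (m : ℕ∞) ≤ {e | I.closure r t e ∧ e ∈ S}.encard) :
    ∀ᶠ H in Filter.atTop, (m : ℕ∞) ≤ {e | e ∈ I.piece r depth H t ∧ e ∈ S}.encard := by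
  obtain ⟨T, hTS, hT⟩ := Set.exists_subset_encard_eq h
  have hTfin : T.Finite := Set.finite_of_encard_eq_coe hT
  obtain ⟨b, hb⟩ := (hTfin.image depth).bddAbove
  filter_upwards [Filter.eventually_gt_atTop b] with H hH
  rw [← hT]
  refine Set.encard_le_encard fun e he => ⟨⟨(hTS he).1, ?_⟩, (hTS he).2⟩
  have := hb ⟨e, he, rfl⟩
  omega

end Directed

/-- Copies of the pieces below the elements `rep e`, for `e` in `V`. An edge that leads from a piece
to an element `e` of its frontier is redirected to the top of a copy of the piece for `e`. -/
def unfolding (I : Interp.{u}) (K : KB) (r : RoleName) (f : IndName) (root : I.dom)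
    (depth : I.dom → ℕ) (rep : I.dom → I.dom) (H : ℕ) (hH : 0 < H) (V : Set I.dom)
    (hV : root ∈ V) : Interp.{u} where
  dom := {x : Bool × I.dom × I.dom // x.2.1 ∈ V ∧ x.2.2 ∈ I.piece r depth H (rep x.2.1)}
  nonempty := ⟨⟨(false, root, rep root), hV, .refl, Nat.lt_add_of_pos_right hH⟩⟩
  conc A := {x | A ∈ K.conceptNames ∧ x.1.2.2 ∈ I.conc A}
  role s x y := s = r ∧
    ((y.1.1 = x.1.1 ∧ y.1.2.1 = x.1.2.1 ∧ I.role r x.1.2.2 y.1.2.2) ∨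
      (I.role r x.1.2.2 y.1.2.1 ∧ depth y.1.2.1 = depth (rep x.1.2.1) + H ∧
        y.1.1 = !x.1.1 ∧ y.1.2.2 = rep y.1.2.1))
  name a := open Classical in if a = f then
    some ⟨(false, root, rep root), hV, .refl, Nat.lt_add_of_pos_right hH⟩ else none
  name_inj := by
    intro a b d ha hb
    split_ifs at ha hb
    simp_all

/-- The direct successors of an element in the unfolding correspond to those in `I`. -/
theorem encard_unfolding_succ {I : Interp.{u}} {K : KB} {r : RoleName} {f : IndName}
    {root : I.dom} {depth : I.dom → ℕ} {rep : I.dom → I.dom} {H : ℕ} {hH : 0 < H} {V : Set I.dom}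
    {hV : root ∈ V} (hdepth : ∀ x y, I.role r x y → depth y = depth x + 1)
    (hVf : ∀ e, I.frontier r depth H (rep e) ⊆ V)
    (hrep : ∀ A ∈ K.conceptNames, ∀ d, rep d ∈ I.conc A ↔ d ∈ I.conc A)
    (x : (I.unfolding K r f root depth rep H hH V hV).dom)
    {B : ConceptName} (hB : B ∈ K.conceptNames) :
    {y | (I.unfolding K r f root depth rep H hH V hV).role r x y ∧
      y ∈ (I.unfolding K r f root depth rep H hH V hV).conc B}.encard =
    {w | I.role r x.1.2.2 w ∧ w ∈ I.conc B}.encard := by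
  classical
  let val : (I.unfolding K r f root depth rep H hH V hV).dom → Bool × I.dom × I.dom := Subtype.val
  have hval : Function.Injective val := Subtype.val_injective
  obtain ⟨⟨b, e, u⟩, he, hu⟩ := x
  dsimp only at he hu
  -- Successors inside the piece stay in the same copy; those on the frontier become tops of copies
  -- with the other Boolean, still indexed by the original `w`, so that siblings with the same
  -- representative remain distinct.
  let g : I.dom → Bool × I.dom × I.dom :=
    fun w => if depth w < depth (rep e) + H then (b, e, w) else (!b, w, rep w)
  have hg : Function.Injective g := by
    intro w w' hww
    dsimp only [g] at hww
    split_ifs at hww <;> simp_all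
  rw [← hval.encard_image, ← hg.encard_image {w | I.role r u w ∧ w ∈ I.conc B}]
  congr 1
  ext z
  constructor
  · rintro ⟨⟨⟨b', e', u'⟩, he', hu'⟩, ⟨⟨-, hrole⟩, -, hyB⟩, rfl⟩
    dsimp only at hrole hyB he' hu' ⊢
    rcases hrole with ⟨rfl, rfl, hrole⟩ | ⟨hrole, hd, rfl, rfl⟩
    · exact ⟨u', ⟨hrole, hyB⟩, if_pos hu'.2⟩
    · exact ⟨e', ⟨hrole, (hrep B hB e').1 hyB⟩, if_neg (by omega)⟩
  · rintro ⟨w, ⟨hw, hwB⟩, rfl⟩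
    have hcl : I.closure r (rep e) w := hu.1.tail hw
    have hd := hdepth _ _ hw
    have hd' := hu.2
    by_cases hlt : depth w < depth (rep e) + H
    · simp only [g, hlt, if_true]
      exact ⟨⟨(b, e, w), he, hcl, hlt⟩, ⟨⟨rfl, Or.inl ⟨rfl, rfl, hw⟩⟩, hB, hwB⟩, rfl⟩
    · have heq : depth w = depth (rep e) + H := by omega
      simp only [g, hlt, if_false]
      exact ⟨⟨(!b, w, rep w), hVf e ⟨hcl, heq⟩, .refl, Nat.lt_add_of_pos_right hH⟩,
        ⟨⟨rfl, Or.inr ⟨hw, heq, rfl, rfl⟩⟩, hB, (hrep B hB w).2 hwB⟩, rfl⟩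

section Unfolding

variable {I : Interp.{u}} {K : KB} {r : RoleName} {f : IndName}
    {root : I.dom} {depth : I.dom → ℕ} {rep : I.dom → I.dom} {H : ℕ} {hH : 0 < H} {V : Set I.dom}
    {hV : root ∈ V}

theorem unfolding_closure_of_closure (hdepth : ∀ x y, I.role r x y → depth y = depth x + 1)
    {b : Bool} {e u w : I.dom} (he : e ∈ V) (hu : u ∈ I.piece r depth H (rep e))
    (huw : I.closure r u w) (hw : w ∈ I.piece r depth H (rep e)) :
    (I.unfolding K r f root depth rep H hH V hV).closure r ⟨(b, e, u), he, hu⟩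
      ⟨(b, e, w), he, hw⟩ := by
  induction huw with
  | refl => exact .refl
  | tail huv hvw ih =>
    rename_i v w
    have hv : v ∈ I.piece r depth H (rep e) := by
      refine ⟨Relation.ReflTransGen.trans hu.1 huv, ?_⟩
      have h1 := hdepth _ _ hvw
      have h2 := hw.2
      omega
    exact (ih hv).tail ⟨rfl, Or.inl ⟨rfl, rfl, hvw⟩⟩

theorem unfolding_closure_of_frontier (hdepth : ∀ x y, I.role r x y → depth y = depth x + 1)
    {b : Bool} {e u e' w : I.dom} (he : e ∈ V) (hu : u ∈ I.piece r depth H (rep e))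
    (hue' : I.closure r u e') (hd : depth e' = depth (rep e) + H)
    (he' : e' ∈ V) (hw : w ∈ I.piece r depth H (rep e')) :
    (I.unfolding K r f root depth rep H hH V hV).closure r ⟨(b, e, u), he, hu⟩
      ⟨(!b, e', w), he', hw⟩ := by
  rcases Relation.ReflTransGen.cases_tail hue' with rfl | ⟨v, huv, hve'⟩
  · have := hu.2
    omega
  · have hv : v ∈ I.piece r depth H (rep e) := by
      refine ⟨Relation.ReflTransGen.trans hu.1 huv, ?_⟩
      have h1 := hdepth _ _ hve'
      omega
    have htop : rep e' ∈ I.piece r depth H (rep e') := ⟨.refl, Nat.lt_add_of_pos_right hH⟩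
    refine ((unfolding_closure_of_closure hdepth he hu huv hv).tail
      (c := ⟨(!b, e', rep e'), he', htop⟩) ⟨rfl, Or.inr ⟨hve', hd, rfl, rfl⟩⟩).trans ?_
    exact unfolding_closure_of_closure hdepth he' htop hw.1 hw

/-- Each edge raises the depth by exactly one, so a path that leaves the piece cannot skip the
frontier level. -/
theorem mem_piece_or_exists_frontier (hdepth : ∀ x y, I.role r x y → depth y = depth x + 1)
    {t u w : I.dom} (hu : u ∈ I.piece r depth H t) (huw : I.closure r u w) :
    w ∈ I.piece r depth H t ∨
      ∃ e', I.closure r u e' ∧ depth e' = depth t + H ∧ I.closure r e' w := by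
  induction huw with
  | refl => exact Or.inl hu
  | tail huv hvw ih =>
    rename_i v w
    rcases ih with hv | ⟨e', h1, h2, h3⟩
    · have hd := hdepth _ _ hvw
      have hd' := hv.2
      rcases Nat.lt_or_ge (depth w) (depth t + H) with hlt | hge
      · exact Or.inl ⟨hv.1.tail hvw, hlt⟩
      · exact Or.inr ⟨w, huv.tail hvw, by omega, .refl⟩
    · exact Or.inr ⟨e', h1, h2, h3.tail hvw⟩

/-- The unfolding realizes all at-least restrictions over the closure of the role. -/
theorem le_encard_unfolding_closure (hdepth : ∀ x y, I.role r x y → depth y = depth x + 1)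
    (hVf : ∀ e, I.frontier r depth H (rep e) ⊆ V) {B : ConceptName} (hB : B ∈ K.conceptNames)
    {m : ℕ} (hlarge : ∀ i ≤ m, ∀ e : I.dom,
      (i : ℕ∞) ≤ {w | I.closure r e w ∧ w ∈ I.conc B}.encard →
      (i : ℕ∞) ≤ {w | w ∈ I.piece r depth H (rep e) ∧ w ∈ I.conc B}.encard)
    (x : (I.unfolding K r f root depth rep H hH V hV).dom)
    (hx : (m : ℕ∞) ≤ {w | I.closure r x.1.2.2 w ∧ w ∈ I.conc B}.encard) :
    (m : ℕ∞) ≤ {y | (I.unfolding K r f root depth rep H hH V hV).closure r x y ∧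
      y ∈ (I.unfolding K r f root depth rep H hH V hV).conc B}.encard := by
  classical
  let val : (I.unfolding K r f root depth rep H hH V hV).dom → Bool × I.dom × I.dom := Subtype.val
  have hval : Function.Injective val := Subtype.val_injective
  obtain ⟨⟨b, e, u⟩, he, hu⟩ := x
  dsimp only at he hu hx
  obtain ⟨X, hXS, hX⟩ := Set.exists_subset_encard_eq hx
  have hXfin : X.Finite := Set.finite_of_encard_eq_coe hX
  have hexit : ∀ w, ∃ e', w ∈ X → w ∉ I.piece r depth H (rep e) →
      I.closure r u e' ∧ depth e' = depth (rep e) + H ∧ I.closure r e' w := by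
    intro w
    by_cases hw : w ∈ X ∧ w ∉ I.piece r depth H (rep e)
    · obtain ⟨e', he'⟩ := (mem_piece_or_exists_frontier hdepth hu (hXS hw.1).1).resolve_left hw.2
      exact ⟨e', fun _ _ => he'⟩
    · exact ⟨w, fun h1 h2 => absurd ⟨h1, h2⟩ hw⟩
  choose ex hex using hexit
  let Y : I.dom → Set I.dom := fun e' => {w | w ∈ X ∧ w ∉ I.piece r depth H (rep e) ∧ ex w = e'}
  -- If `i` of the chosen witnesses leave through `e'`, then `e'` reaches at least `i ≤ m` instances
  -- of `B`, and `hlarge` finds as many in the piece below `rep e'` to replace them.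
  have hY : ∀ e', ∃ g : I.dom → I.dom,
      Y e' ⊆ g ⁻¹' {w | w ∈ I.piece r depth H (rep e') ∧ w ∈ I.conc B} ∧ Set.InjOn g (Y e') := by
    intro e'
    have hYX : Y e' ⊆ X := fun w hw => hw.1
    have hYfin : (Y e').Finite := hXfin.subset hYX
    have hcard : ((Y e').ncard : ℕ∞) = (Y e').encard := hYfin.cast_ncard_eq
    have hle : (Y e').ncard ≤ m := by
      have := Set.encard_le_encard hYX
      rw [hX, ← hcard] at this
      exact_mod_cast this
    have : Nonempty I.dom := I.nonempty
    refine hYfin.exists_injOn_of_encard_le ?_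
    rw [← hcard]
    refine hlarge _ hle e' ?_
    rw [hcard]
    refine Set.encard_le_encard ?_
    rintro w ⟨hwX, hwp, rfl⟩
    exact ⟨(hex w hwX hwp).2.2, (hXS hwX).2⟩
  choose g hgmaps hginj using hY
  have hg : ∀ w ∈ X, w ∉ I.piece r depth H (rep e) →
      g (ex w) w ∈ I.piece r depth H (rep (ex w)) ∧ g (ex w) w ∈ I.conc B :=
    fun w h1 h2 => hgmaps (ex w) ⟨h1, h2, rfl⟩
  rw [← hX, ← hval.encard_image]
  -- The Boolean separates witnesses kept in the current copy from replaced ones, even if `ex w =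
  -- e`; the index `ex w` separates those that leave through different frontier elements.
  refine Set.encard_le_encard_of_injOn (f := fun w =>
    if w ∈ I.piece r depth H (rep e) then (b, e, w) else (!b, ex w, g (ex w) w)) ?_ ?_
  · intro w hw
    by_cases hp : w ∈ I.piece r depth H (rep e)
    · simp only [hp, if_true]
      exact ⟨⟨(b, e, w), he, hp⟩, ⟨unfolding_closure_of_closure hdepth he hu (hXS hw).1 hp, hB,
        (hXS hw).2⟩, rfl⟩
    · simp only [hp, if_false]
      obtain ⟨h1, h2, -⟩ := hex w hw hp
      have hV' : ex w ∈ V := hVf e ⟨Relation.ReflTransGen.trans hu.1 h1, h2⟩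
      exact ⟨⟨(!b, ex w, g (ex w) w), hV', (hg w hw hp).1⟩,
        ⟨unfolding_closure_of_frontier hdepth he hu h1 h2 hV' (hg w hw hp).1, hB,
          (hg w hw hp).2⟩, rfl⟩
  · intro w hw w' hw' hww
    dsimp only at hww
    split_ifs at hww with h1 h2 h2
    · simpa using hww
    · simp at hww
    · simp at hww
    · simp only [Prod.mk.injEq, true_and] at hww
      refine hginj (ex w) ⟨hw, h1, rfl⟩ ⟨hw', h2, hww.1.symm⟩ ?_
      rw [hww.2, hww.1]

end Unfolding

/-- A directed tree-shaped counter-model of finite degree of an `ALCQ⁺` knowledge base without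
at-most restrictions over closures can be turned into a finite counter-model. -/
theorem IsCounterModel.exists_finite_of_isALCQ {I : Interp.{u}} {K : KB} {r : RoleName}
    {f : IndName} {Θ : Set (Set ConceptName)} {Q : UCQ} {root : I.dom}
    {parent : I.dom → Option I.dom} {M : ℕ}
    (hI : I.IsCounterModel K Θ Q) (hK : K.IsALCQ) (hK' : K.NoAtMostClosure)
    (hM : ∀ A n s B, CI.atLeastClosure A n s B ∈ K.tbox → n ≤ M) (hr : K.IsSingleRole r)
    (hf : K.IsABoxTrivial f) (hroot : I.name f = some root)
    (hedge : ∀ x y, I.role r x y → parent y = some x) (hfin : ∀ x, {y | I.role r x y}.Finite)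
    (F : Folding parent (I.nodeLabel K r root parent M) Q.size) :
    ∃ J : Interp.{u}, Finite J.dom ∧ J.IsCounterModel K Θ Q := by
  obtain ⟨⟨htbox, habox⟩, hΘ, hQ⟩ := hI
  have hdepth : ∀ x y, I.role r x y → F.depth y = F.depth x + 1 :=
    fun x y h => F.depth_child x y (hedge x y h)
  let rep : I.dom → I.dom := fun d => (Quotient.mk F.equiv d).out
  have hrepE : ∀ d, F.equiv (rep d) d := fun d => Quotient.exact (Quotient.out_eq _)
  have hreplab := fun d => F.lab_congr (hrepE d)
  have hrepfin : (Set.range rep).Finite := by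
    have := F.finite_quotient
    refine (Set.finite_range (Quotient.out : Quotient F.equiv → I.dom)).subset ?_
    rintro _ ⟨d, rfl⟩
    exact ⟨_, rfl⟩
  have hreproot : rep root = root := (eq_root_iff_of_nodeLabel_eq (hreplab root)).2 rfl
  have hrepconc : ∀ A ∈ K.conceptNames, ∀ d, rep d ∈ I.conc A ↔ d ∈ I.conc A :=
    fun A hA d => mem_conc_iff_of_nodeLabel_eq (hreplab d) hA
  -- There are finitely many requirements, one for each representative, concept name and number up
  -- to `M`, and each holds for all large `H`.
  obtain ⟨H, hlarge, hH⟩ : ∃ H, (∀ x : Set.range rep × K.conceptNames × Fin (M + 1),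
      ((x.2.2 : ℕ) : ℕ∞) ≤ {e | I.closure r x.1 e ∧ e ∈ I.conc x.2.1}.encard →
      ((x.2.2 : ℕ) : ℕ∞) ≤ {e | e ∈ I.piece r F.depth H x.1 ∧ e ∈ I.conc x.2.1}.encard) ∧
      0 < H := by
    have := hrepfin.to_subtype
    have := K.finite_conceptNames.to_subtype
    refine ((Filter.eventually_all.2 fun x => ?_).and (Filter.eventually_gt_atTop 0)).exists
    by_cases hx : ((x.2.2 : ℕ) : ℕ∞) ≤ {e | I.closure r x.1 e ∧ e ∈ I.conc x.2.1}.encard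
    · filter_upwards [eventually_le_encard_piece (depth := F.depth) _ _ _ hx] with H h _
      exact h
    · exact Filter.Eventually.of_forall fun H h => absurd h hx
  -- Frontiers are taken below all representatives at once, so the index set is closed under
  -- redirection without iteration.
  let V : Set I.dom := {root} ∪ ⋃ t ∈ Set.range rep, I.frontier r F.depth H t
  have hV : root ∈ V := Or.inl rfl
  have hVf : ∀ e, I.frontier r F.depth H (rep e) ⊆ V :=
    fun e d hd => Or.inr (Set.mem_biUnion (x := rep e) ⟨e, rfl⟩ hd)
  have hVfin : V.Finite := (Set.finite_singleton root).union
    (hrepfin.biUnion fun t _ => finite_frontier hdepth hfin H t)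
  have hsucc := fun x {B} => encard_unfolding_succ (f := f) (hH := hH) (hV := hV) hdepth hVf
    hrepconc x (B := B)
  have hclos := fun B (hB : B ∈ K.conceptNames) m (hm : m ≤ M) =>
    le_encard_unfolding_closure (f := f) (hH := hH) (hV := hV) hdepth hVf hB (m := m)
      fun i hi e he => hlarge (⟨rep e, e, rfl⟩, ⟨B, hB⟩, ⟨i, by omega⟩)
        ((le_encard_iff_of_nodeLabel_eq (hreplab e) hB (hi.trans hm)).2 he)
  set J := I.unfolding K r f root F.depth rep H hH V hV with hJ
  refine ⟨J, ?_, ⟨fun c hc => ?_, fun α hα => ?_⟩,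
    fun x => ?_, fun hJQ => hQ ?_⟩
  · refine Set.Finite.to_subtype ?_
    refine ((Set.finite_univ (α := Bool)).prod (hVfin.prod
      (hVfin.biUnion fun e _ => finite_piece hdepth hfin H (rep e)))).subset ?_
    rintro ⟨b, e, u⟩ ⟨he, hu⟩
    exact ⟨trivial, he, Set.mem_biUnion (x := e) he hu⟩
  · have hcI := htbox c hc
    have hinv := hK c hc
    have hmost := hK' c hc
    have hCN := fun {A} (hA : A ∈ c.conceptNames) => KB.mem_conceptNames hc hA
    cases c with
    | bool As Bs =>
      intro x hx
      obtain ⟨B, hB, hdB⟩ := hcI x.1.2.2 fun A hA => (hx A hA).2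
      exact ⟨B, hB, hCN (Or.inr hB), hdB⟩
    | atMost A n s B =>
      obtain rfl : s = r := hr.eq hc rfl
      intro x hx
      rw [hsucc x (hCN (Or.inr rfl))]
      exact hcI _ hx.2
    | atLeast A n s B =>
      obtain rfl : s = r := hr.eq hc rfl
      intro x hx
      rw [hsucc x (hCN (Or.inr rfl))]
      exact hcI _ hx.2
    | atMostClosure A n s B => exact hmost.elim
    | atLeastClosure A n s B =>
      obtain rfl : s = r := hr.eq hc rfl
      intro x hx
      exact hclos B (hCN (Or.inr rfl)) n (hM _ _ _ _ hc) x (hcI _ hx.2)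
    | allInv A s B => exact hinv.elim
    | exInv A s B => exact hinv.elim
    | exInvClosure A s B => exact hinv.elim
  · obtain ⟨A, hA, rfl⟩ := hf.eq_concept hα
    obtain ⟨d, hd, hdA⟩ := habox _ hα
    rw [hroot] at hd
    cases hd
    exact ⟨_, if_pos rfl, hA, (hrepconc A hA root).2 hdA⟩
  · convert hΘ x.1.2.2 using 1
    ext A
    exact and_congr_right fun hA => and_iff_right hA
  -- Projection to the tree keeps edges inside a copy; a redirected edge ends in `rep e`, which is
  -- equivalent to the true target `e`.
  · refine satUCQ_of_folding hroot (fun x y h => Or.inl (hedge x y h)) F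
      (fun x : J.dom => x.1.2.2)
      (fun A x hx => hx) ?_ ?_ hJQ
    · rintro s x y ⟨rfl, ⟨-, -, h⟩ | ⟨h, -, -, hy⟩⟩
      · exact ⟨rfl, _, _, F.equiv.refl _, F.equiv.refl _, h⟩
      · refine ⟨rfl, _, _, F.equiv.refl _, ?_, h⟩
        rw [hy]
        exact F.equiv.symm (hrepE _)
    · intro a x hx
      by_cases ha : a = f
      · have hx' := (if_pos ha).symm.trans hx
        cases hx'
        exact ⟨ha, hreproot⟩
      · have hx' := (if_neg ha).symm.trans hx
        cases hx'

/-! ### Unravelling finite counter-models -/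

/-- The last element of a path from `d₀`, which is the head of the list. -/
def pathEnd {α : Type u} (d₀ : α) : List (Bool × α) → α
  | [] => d₀
  | x :: _ => x.2

/-- Paths from `d₀`, with steps along edges (`true`), and against edges (`false`) if `back`
holds. -/
def IsPath (I : Interp.{u}) (r : RoleName) (back : Prop) (d₀ : I.dom) :
    List (Bool × I.dom) → Prop
  | [] => True
  | (true, d) :: l => I.role r (pathEnd d₀ l) d ∧ I.IsPath r back d₀ l
  | (false, d) :: l => (back ∧ I.role r d (pathEnd d₀ l)) ∧ I.IsPath r back d₀ l

theorem IsPath.tail {I : Interp.{u}} {r : RoleName} {back : Prop} {d₀ : I.dom} :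
    ∀ {x : Bool × I.dom} {l : List (Bool × I.dom)}, I.IsPath r back d₀ (x :: l) →
      I.IsPath r back d₀ l
  | (true, _), _, h => h.2
  | (false, _), _, h => h.2

/-- The unravelling of an interpretation from `d₀`. -/
def unravel (I : Interp.{u}) (r : RoleName) (f : IndName) (back : Prop) (d₀ : I.dom) :
    Interp.{u} where
  dom := {l : List (Bool × I.dom) // I.IsPath r back d₀ l}
  nonempty := ⟨⟨[], trivial⟩⟩
  conc A := {x | pathEnd d₀ x.1 ∈ I.conc A}
  role s x y := s = r ∧ ((∃ d, y.1 = (true, d) :: x.1) ∨ ∃ d, x.1 = (false, d) :: y.1)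
  name a := open Classical in if a = f then some ⟨[], trivial⟩ else none
  name_inj := by
    intro a b d ha hb
    split_ifs at ha hb
    simp_all

/-- The initial part of a path. -/
def unravelParent {I : Interp.{u}} {r : RoleName} {back : Prop} {d₀ : I.dom} :
    {l : List (Bool × I.dom) // I.IsPath r back d₀ l} →
      Option {l : List (Bool × I.dom) // I.IsPath r back d₀ l}
  | ⟨[], _⟩ => none
  | ⟨_ :: l, h⟩ => some ⟨l, h.tail⟩

theorem isTreeArrangement_unravel {I : Interp.{u}} {r : RoleName} {back : Prop} {d₀ : I.dom} :
    IsTreeArrangement (⟨[], trivial⟩ : {l : List (Bool × I.dom) // I.IsPath r back d₀ l})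
      unravelParent := by
  refine ⟨rfl, ?_⟩
  rintro ⟨l, hl⟩
  induction l with
  | nil => exact .refl
  | cons x l ih => exact .head rfl (ih hl.tail)

section Unravel

variable {I : Interp.{u}} {r : RoleName} {f : IndName} {back : Prop} {d₀ : I.dom}

theorem unravel_parent {x y : (I.unravel r f back d₀).dom} {a : Bool × I.dom}
    (h : y.1 = a :: x.1) : unravelParent y = some x := by
  obtain ⟨l, hl⟩ := y
  cases h
  rfl

theorem isTreeShaped_unravel {K : KB} (hback : K.IsALCQ → ¬ back) :
    (I.unravel r f back d₀).IsTreeShaped K r f := by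
  refine ⟨⟨[], trivial⟩, unravelParent, if_pos rfl, isTreeArrangement_unravel, ?_, ?_⟩
  · rintro x y ⟨-, ⟨d, h⟩ | ⟨d, h⟩⟩
    · exact Or.inl (unravel_parent h)
    · exact Or.inr (unravel_parent h)
  · rintro hK ⟨x, hx⟩ y ⟨-, ⟨d, h⟩ | ⟨d, h⟩⟩
    · exact unravel_parent h
    · cases h
      exact absurd hx.1.1 (hback hK)

theorem hasBoundedDegree_unravel [Finite I.dom] :
    (I.unravel r f back d₀).HasBoundedDegree r := by
  let val : (I.unravel r f back d₀).dom → List (Bool × I.dom) := Subtype.val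
  have hval : Function.Injective val := Subtype.val_injective
  have hfin : (Set.univ : Set (Bool × I.dom)).Finite := Set.finite_univ
  -- The neighbours of a path are among its tail and its one-step extensions.
  refine ⟨1 + hfin.toFinset.card, fun x => ?_⟩
  rw [← hval.encard_image]
  have hsub : val '' {y | (I.unravel r f back d₀).role r x y ∨
      (I.unravel r f back d₀).role r y x} ⊆ {(val x).tail} ∪ (fun a => a :: val x) '' Set.univ := by
    rintro _ ⟨y, ⟨-, ⟨d, h⟩ | ⟨d, h⟩⟩ | ⟨-, ⟨d, h⟩ | ⟨d, h⟩⟩, rfl⟩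
    · exact Or.inr ⟨_, trivial, h.symm⟩
    · exact Or.inl (by simp [val, h])
    · exact Or.inl (by simp [val, h])
    · exact Or.inr ⟨_, trivial, h.symm⟩
  refine (Set.encard_le_encard hsub).trans ((Set.encard_union_le _ _).trans ?_)
  rw [Set.encard_singleton, Nat.cast_add, Nat.cast_one, ← hfin.encard_eq_coe_toFinset_card]
  gcongr
  exact Set.encard_image_le _ _

/-- The projection of the unravelling to the interpretation. -/
def unravelProj (x : (I.unravel r f back d₀).dom) : I.dom := pathEnd d₀ x.1

theorem role_unravelProj {s : RoleName} {x y : (I.unravel r f back d₀).dom}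
    (h : (I.unravel r f back d₀).role s x y) : I.role s (unravelProj x) (unravelProj y) := by
  obtain ⟨x, hx⟩ := x
  obtain ⟨y, hy⟩ := y
  obtain ⟨rfl, ⟨d, h⟩ | ⟨d, h⟩⟩ := h
  · cases h
    exact hy.1
  · cases h
    exact hx.1.2

theorem closure_unravelProj {s : RoleName} {x y : (I.unravel r f back d₀).dom}
    (h : (I.unravel r f back d₀).closure s x y) : I.closure s (unravelProj x) (unravelProj y) :=
  Relation.ReflTransGen.lift unravelProj (fun _ _ => role_unravelProj) _ _ h

theorem exists_unravel_succ (x : (I.unravel r f back d₀).dom) {e : I.dom}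
    (h : I.role r (unravelProj x) e) :
    ∃ y, (I.unravel r f back d₀).role r x y ∧ unravelProj y = e :=
  ⟨⟨(true, e) :: x.1, h, x.2⟩, ⟨rfl, Or.inl ⟨e, rfl⟩⟩, rfl⟩

theorem exists_unravel_pred (hback : back) (x : (I.unravel r f back d₀).dom) {e : I.dom}
    (h : I.role r e (unravelProj x)) :
    ∃ y, (I.unravel r f back d₀).role r y x ∧ unravelProj y = e :=
  ⟨⟨(false, e) :: x.1, ⟨hback, h⟩, x.2⟩, ⟨rfl, Or.inr ⟨e, rfl⟩⟩, rfl⟩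

theorem exists_unravel_closure (x : (I.unravel r f back d₀).dom) {e : I.dom}
    (h : I.closure r (unravelProj x) e) :
    ∃ y, (I.unravel r f back d₀).closure r x y ∧ unravelProj y = e := by
  induction h with
  | refl => exact ⟨x, .refl, rfl⟩
  | tail _ hde ih =>
    obtain ⟨y, hxy, rfl⟩ := ih
    obtain ⟨z, hyz, rfl⟩ := exists_unravel_succ y hde
    exact ⟨z, hxy.tail hyz, rfl⟩

theorem exists_unravel_closure_inv (hback : back) (x : (I.unravel r f back d₀).dom) {e : I.dom}
    (h : I.closure r e (unravelProj x)) :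
    ∃ y, (I.unravel r f back d₀).closure r y x ∧ unravelProj y = e := by
  induction h using Relation.ReflTransGen.head_induction_on with
  | refl => exact ⟨x, .refl, rfl⟩
  | head hde _ ih =>
    obtain ⟨y, hyx, rfl⟩ := ih
    obtain ⟨z, hzy, rfl⟩ := exists_unravel_pred hback y hde
    exact ⟨z, hyx.head hzy, rfl⟩

/-- Without backward steps, every successor of `x` extends `x` by one forward step and is determined
by its endpoint. A backward last step of `x` would make the parent a further successor, possibly
with the same endpoint as a child. -/
theorem injOn_unravelProj_succ (hback : ¬ back) (x : (I.unravel r f back d₀).dom) :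
    Set.InjOn unravelProj {y | (I.unravel r f back d₀).role r x y} := by
  have hsucc : ∀ y, (I.unravel r f back d₀).role r x y → ∃ d, y.1 = (true, d) :: x.1 := by
    rintro y ⟨-, h | ⟨d, h⟩⟩
    · exact h
    · obtain ⟨l, hl⟩ := x
      cases h
      exact absurd hl.1.1 hback
  intro y hy z hz hyz
  obtain ⟨d, hd⟩ := hsucc y hy
  obtain ⟨e, he⟩ := hsucc z hz
  have h1 : d = e := by simpa only [unravelProj, hd, he, pathEnd] using hyz
  exact Subtype.ext (by rw [hd, he, h1])

theorem satUCQ_of_unravel {Q : UCQ} (hf : I.name f = some d₀)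
    (h : (I.unravel r f back d₀).SatUCQ Q) : I.SatUCQ Q := by
  obtain ⟨q, hq, η, hη⟩ := h
  have heval : ∀ {t x}, (I.unravel r f back d₀).eval η t = some x →
      I.eval (fun v => unravelProj (η v)) t = some (unravelProj x) := by
    intro t x h
    cases t with
    | var v => cases h; rfl
    | ind a =>
      by_cases ha : a = f
      · have hx' := (if_pos ha).symm.trans h
        cases hx'
        rw [ha]
        exact hf
      · have hx' := (if_neg ha).symm.trans h
        cases hx'
  refine ⟨q, hq, fun v => unravelProj (η v), fun α hα => ?_⟩
  have hsat := hη α hα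
  cases α with
  | concept A t =>
    obtain ⟨x, hx, hA⟩ := hsat
    exact ⟨_, heval hx, hA⟩
  | eq t t' =>
    obtain ⟨x, hx, hx'⟩ := hsat
    exact ⟨_, heval hx, heval hx'⟩
  | role p t t' =>
    obtain ⟨x, y, hx, hy, hxy⟩ := hsat
    exact ⟨_, _, heval hx, heval hy, role_unravelProj hxy⟩

end Unravel

/-- At-least restrictions hold since witnesses lift along the projection, and at-most restrictions
with bound 0 since it is a homomorphism. Larger bounds occur only for ALCQ⁺, where the projection is
injective on successors. -/
theorem IsCounterModel.unravel {I : Interp.{u}} {K : KB} {r : RoleName} {f : IndName}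
    {Θ : Set (Set ConceptName)} {Q : UCQ} {d₀ : I.dom} (hI : I.IsCounterModel K Θ Q)
    (hK : K.IsALCI ∨ (K.IsALCQ ∧ K.NoAtMostClosure)) (hr : K.IsSingleRole r)
    (hf : K.IsABoxTrivial f) (hd₀ : I.name f = some d₀) :
    (I.unravel r f (¬ K.IsALCQ) d₀).IsCounterModel K Θ Q := by
  obtain ⟨⟨htbox, habox⟩, hΘ, hQ⟩ := hI
  refine ⟨⟨fun c hc => ?_, fun α hα => ?_⟩, fun x => hΘ (unravelProj x),
    fun h => hQ (satUCQ_of_unravel hd₀ h)⟩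
  · have hcI := htbox c hc
    -- An inclusion with an inverse role shows that `K` is not ALCQ⁺, so backward steps are
    -- available for its witnesses.
    have hback : ¬ c.InverseFree → ¬ K.IsALCQ := fun h h' => h (h' c hc)
    cases c with
    | bool As Bs => exact fun x => hcI (unravelProj x)
    | atMost A n s B =>
      obtain rfl : s = r := hr.eq hc rfl
      intro x hx
      by_cases hQ : K.IsALCQ
      · refine le_trans (Set.encard_le_encard_of_injOn (f := unravelProj) ?_ ?_)
          (hcI (unravelProj x) hx)
        · exact fun y hy => ⟨role_unravelProj hy.1, hy.2⟩
        · exact (injOn_unravelProj_succ (not_not.2 hQ) x).mono fun y hy => hy.1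
      · have hn : n = 0 := (hK.resolve_right fun h => hQ h.1) _ hc
        have h0 := hcI (unravelProj x) hx
        simp only [hn, Nat.cast_zero, nonpos_iff_eq_zero, Set.encard_eq_zero,
          Set.eq_empty_iff_forall_notMem] at h0 ⊢
        exact fun y hy => h0 (unravelProj y) ⟨role_unravelProj hy.1, hy.2⟩
    | atLeast A n s B =>
      obtain rfl : s = r := hr.eq hc rfl
      intro x hx
      refine (hcI (unravelProj x) hx).trans (le_trans (Set.encard_le_encard ?_)
        (Set.encard_image_le unravelProj _))
      rintro e ⟨he, heB⟩
      obtain ⟨y, hy, rfl⟩ := exists_unravel_succ x he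
      exact ⟨y, ⟨hy, heB⟩, rfl⟩
    | atMostClosure A n s B =>
      obtain rfl : s = r := hr.eq hc rfl
      intro x hx
      have hn : n = 0 := (hK.resolve_right fun h => h.2 _ hc) _ hc
      have h0 := hcI (unravelProj x) hx
      simp only [hn, Nat.cast_zero, nonpos_iff_eq_zero, Set.encard_eq_zero,
        Set.eq_empty_iff_forall_notMem] at h0 ⊢
      exact fun y hy => h0 (unravelProj y) ⟨closure_unravelProj hy.1, hy.2⟩
    | atLeastClosure A n s B =>
      obtain rfl : s = r := hr.eq hc rfl
      intro x hx
      refine (hcI (unravelProj x) hx).trans (le_trans (Set.encard_le_encard ?_)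
        (Set.encard_image_le unravelProj _))
      rintro e ⟨he, heB⟩
      obtain ⟨y, hy, rfl⟩ := exists_unravel_closure x he
      exact ⟨y, ⟨hy, heB⟩, rfl⟩
    | allInv A s B =>
      exact fun x hx y hyx => hcI (unravelProj x) hx (unravelProj y) (role_unravelProj hyx)
    | exInv A s B =>
      obtain rfl : s = r := hr.eq hc rfl
      intro x hx
      obtain ⟨e, he, heB⟩ := hcI (unravelProj x) hx
      obtain ⟨y, hy, rfl⟩ := exists_unravel_pred (hback id) x he
      exact ⟨y, hy, heB⟩
    | exInvClosure A s B =>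
      obtain rfl : s = r := hr.eq hc rfl
      intro x hx
      obtain ⟨e, he, heB⟩ := hcI (unravelProj x) hx
      obtain ⟨y, hy, rfl⟩ := exists_unravel_closure_inv (hback id) x he
      exact ⟨y, hy, heB⟩
  · obtain ⟨A, hA, rfl⟩ := hf.eq_concept hα
    obtain ⟨d, hd, hdA⟩ := habox _ hα
    rw [hd₀] at hd
    cases hd
    exact ⟨_, if_pos rfl, hdA⟩

end Interp

theorem KB.exists_le_of_atLeastClosure (K : KB) :
    ∃ M, ∀ A n s B, CI.atLeastClosure A n s B ∈ K.tbox → n ≤ M := by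
  let num : CI → ℕ := fun c => match c with
    | .atLeastClosure _ n _ _ => n
    | _ => 0
  exact ⟨K.tbox.sup num, fun A n s B h => Finset.le_sup (f := num) h⟩

end DL

theorem mainTheorem5 (K : DL.KB) (r : DL.RoleName) (f : DL.IndName)
    (hrole : K.IsSingleRole r) (habox : K.IsABoxTrivial f)
    (hlogic : K.IsALCI ∨ (K.IsALCQ ∧ K.NoAtMostClosure))
    (Θ : Set (Set DL.ConceptName)) (Q : DL.UCQ) :
    ¬ DL.FinEntails.{u} K Θ Q ↔
      ∃ I : DL.Interp.{u}, I.IsTreeShaped K r f ∧ I.HasBoundedDegree r ∧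
        I.IsCounterModel K Θ Q := by
  constructor
  · intro h
    simp only [DL.FinEntails, not_forall] at h
    obtain ⟨I, hfin, hΘ, hK, hQ⟩ := h
    -- An ABox assertion about `f` forces `f` into the domain, which gives the starting point of the
    -- unravelling.
    obtain ⟨α, hα⟩ := K.abox_nonempty
    obtain ⟨A, -, rfl⟩ := habox.eq_concept hα
    obtain ⟨d₀, hd₀, -⟩ := hK.2 _ hα
    exact ⟨I.unravel r f (¬ K.IsALCQ) d₀, DL.Interp.isTreeShaped_unravel not_not.2,
      DL.Interp.hasBoundedDegree_unravel,
      DL.Interp.IsCounterModel.unravel ⟨hK, hΘ, hQ⟩ hlogic hrole habox hd₀⟩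
  · rintro ⟨I, ⟨root, parent, hroot, htree, hedge, hdir⟩, ⟨k, hk⟩, hI⟩
    have hCN := K.finite_conceptNames.to_subtype
    suffices h : ∃ J : DL.Interp.{u}, Finite J.dom ∧ J.IsCounterModel K Θ Q by
      obtain ⟨J, hfin, hJ, hJΘ, hJQ⟩ := h
      exact fun hent => hJQ (hent J hfin hJΘ hJ)
    rcases hlogic with hK | ⟨hK, hK'⟩
    -- Without counting, labels need only tell whether an instance is reachable, so the cap is 1.
    · obtain ⟨F⟩ := htree.exists_folding (I.nodeLabel K r root parent 1) Q.size
      exact ⟨_, F.finite_quotient, hI.quotient hK hrole habox hroot hedge F⟩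
    · obtain ⟨M, hM⟩ := K.exists_le_of_atLeastClosure
      obtain ⟨F⟩ := htree.exists_folding (I.nodeLabel K r root parent M) Q.size
      refine hI.exists_finite_of_isALCQ hK hK' hM hrole habox hroot (hdir hK) (fun x => ?_) F
      exact (Set.finite_of_encard_le_coe (hk x)).subset fun y hy => Or.inl hy
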